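/- **Setting.** Let $V:\mathbb Z^d\to[0,+\infty]$ with $V(0)=0$ and let $\alpha>0$. Let $\Gamma$ be the set of finite cycles of length at least $2$ on $\mathbb Z^d$, i.e. cyclic permutations $\gamma$ of $\mathbb Z^d$ with finite support $\{\gamma\}=\{x:\gamma(x)\neq x\}$, and put $$w(\gamma)=\exp\Bigl(-\alpha\sum_{x\in\{\gamma\}}V(\gamma(x)-x)\Bigr),\qquad \gamma\in\Gamma\qquad(e^{-\infty}=0).$$ Two cycles are *compatible* if their supports are disjoint. A configuration $\eta\in\{0,1\}^\Gamma$ is a *finite-cycle configuration* if the cycles $\gamma$ with $\eta(\gamma)=1$ are pairwise compatible; it then represents the permutation composed of these cycles. Let $\mathcal N$ be a Poisson process on $\Gamma\times\mathbb R\times\mathbb R^+$ with intensity $w(\gamma)\,dt\,e^{-s}ds$; a point $(\gamma,t,s)$ is an attempt of $\gamma$ to be born at time $t$ with lifetime $s$. **Graphical construction.** For a set $M$ of points and a point $\varphi=(\gamma,t,s)$ let $\mathcal A_1^\varphi(M)$ be the set of all $(\gamma',t',s')\in M$ such that $\gamma'$ is not compatible with $\gamma$ and $t'<t<t'+s'$.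 Let $\mathcal A_{n+1}^\varphi(M)=\bigcup_{\varphi'\in\mathcal A_n^\varphi(M)}\mathcal A_1^{\varphi'}(M)$, and let $\mathcal A^\varphi(M)=\bigcup_{n\ge1}\mathcal A_n^\varphi(M)$ be the *clan of ancestors* of $\varphi$. Set $\mathcal D_0=\emptyset$ and, for $n\ge1$, $$\mathcal K_n=\{\varphi\in M:\mathcal A_1^\varphi(M)\setminus\mathcal D_{n-1}=\emptyset\},\qquad \mathcal D_n=\{\varphi\in M:\mathcal A_1^\varphi(M)\cap\mathcal K_n\ne\emptyset\},$$ and let $\mathcal K(M)=\bigcup_n\mathcal K_n$ be the set of *kept* points. The *loss network driven by $M$* is $$\eta_t(M)(\gamma)=\mathbf 1\{\text{there is }(\gamma,t',s')\in\mathcal K(M)\text{ with }t'\le t<t'+s'\}.$$ The stationary loss network is $\eta_t=\eta_t(\mathcal N)$, and $\mu$ denotes its law at a fixed time. **Dynamics and invariant measures.** The loss network dynamics has the formal generator $$\mathcal Lf(\eta)=\sum_{\gamma\in\Gamma}w(\gamma)\mathbf 1\{\gamma\sim\eta\}[f(\eta+\delta_\gamma)-f(\eta)]+\sum_{\gamma\in\Gamma}\eta(\gamma)[f(\eta-\delta_\gamma)-f(\eta)],$$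 where $\gamma\sim\eta$ means that $\gamma$ is compatible with all cycles of $\eta$. It is realized graphically: started at time $0$ from $\eta'$, its state at time $t\ge0$ is $$\eta_t\bigl(\{(\theta,0,s(\theta)):\eta'(\theta)=1\}\cup\{(\gamma,t',s)\in\mathcal N:t'\ge0\}\bigr),$$ where $(s(\theta))_{\theta\in\Gamma}$ are i.i.d. exponential of rate $1$, and $(s(\theta))_{\theta}$, $\mathcal N$ and $\eta'$ (if random) are independent. A probability measure $\nu$ on $\{0,1\}^\Gamma$ is *invariant* if this state has law $\nu$ for every $t\ge0$ when $\eta'$ has law $\nu$ (for every realization of the Poisson process on a probability space). **Theorem (uniqueness).** Assume that, for almost all realizations of $\mathcal N$, the clan of ancestors $\mathcal A^\varphi(\mathcal N)$ is finite for every $\varphi\in\Gamma\times\mathbb R\times\mathbb R^+$. Let $\nu$ be an invariant probability measure for the loss network dynamics such that $\nu$-almost every configuration is a finite-cycle configuration. Then $\nu=\mu$; that is, for every $t\in\mathbb R$ the law of $\eta_t(\mathcal N)$ is $\nu$. -/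

import Mathlib

open MeasureTheory ProbabilityTheory
open scoped ENNReal

universe u

noncomputable section

namespace LossNetwork

/-- Finite cycles of length at least two on the lattice of dimension `d`. -/
def FiniteCycle (d : ℕ) : Type :=
  {γ : Equiv.Perm (Fin d → ℤ) // γ.IsCycle ∧ {x | γ x ≠ x}.Finite}

/-- The finite set of sites moved by a cycle. -/
def FiniteCycle.supp {d : ℕ} (γ : FiniteCycle d) : Finset (Fin d → ℤ) :=
  γ.2.2.toFinset

/-- The set of finite cycles is countable; it carries the discrete sigma-algebra. -/
instance (d : ℕ) : MeasurableSpace (FiniteCycle d) := ⊤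

/-- Two cycles are compatible if their supports are disjoint. -/
def Compatible {d : ℕ} (γ θ : FiniteCycle d) : Prop := Disjoint γ.supp θ.supp

/-- The weight `exp (-α * ∑ x ∈ supp γ, V (γ x - x))`, which is `0` if the sum is infinite. -/
def weight {d : ℕ} (V : (Fin d → ℤ) → ℝ≥0∞) (α : ℝ) (γ : FiniteCycle d) : ℝ≥0∞ :=
  EReal.exp (-(α : EReal) * ((∑ x ∈ γ.supp, V (γ.1 x - x) : ℝ≥0∞) : EReal))

/-- A point `(γ, t, s)`: the cycle `γ` attempts to be born at time `t` with lifetime `s`. -/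
abbrev Point (d : ℕ) : Type := FiniteCycle d × ℝ × ℝ

/-- A configuration in `{0,1}^Γ`, as the set of cycles which are present. The sigma-algebra is
the product one, generated by the events `γ ∈ η`. -/
abbrev Config (d : ℕ) : Type := Set (FiniteCycle d)

/-- The cycles of the configuration are pairwise compatible, that is, they are the cycles of a
finite-cycle permutation of the lattice. -/
def IsFiniteCycleConfig {d : ℕ} (η : Config d) : Prop := η.Pairwise Compatible

/-! ### Poisson processes -/

/-- `N` is a (simple) Poisson point process with diffuse intensity measure `m`, viewed as a
random set of points: the number of points in a measurable set of finite intensity has a Poisson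
law, and the numbers of points in disjoint measurable sets are independent. -/
structure IsPoissonPointProc {Ω E : Type*} [MeasurableSpace Ω] [MeasurableSpace E]
    (N : Ω → Set E) (m : Measure E) (P : Measure Ω) : Prop where
  measurable_count : ∀ B : Set E, MeasurableSet B → Measurable fun ω => (N ω ∩ B).encard
  count_law : ∀ B : Set E, MeasurableSet B → m B ≠ ∞ → ∀ k : ℕ,
    P {ω | (N ω ∩ B).encard = (k : ℕ∞)} = poissonMeasure (m B).toNNReal {k}
  indep : ∀ (n : ℕ) (B : Fin n → Set E), (∀ i, MeasurableSet (B i)) →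
    Pairwise (fun i j => Disjoint (B i) (B j)) →
    iIndepFun (fun (i : Fin n) (ω : Ω) => (N ω ∩ B i).encard) P

/-- The intensity measure `w(γ) dt e^{-s} ds`, with `s ≥ 0`, on the space of points. -/
def intensity {d : ℕ} (V : (Fin d → ℤ) → ℝ≥0∞) (α : ℝ) : Measure (Point d) :=
  (Measure.count.withDensity (weight V α)).prod
    ((volume : Measure ℝ).prod (expMeasure 1))

/-! ### Clans of ancestors, kept points, and the loss network driven by a set of points -/

variable {d : ℕ}

/-- First generation of ancestors of `φ` in the set of points `M`: the points whose cycle is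
incompatible with that of `φ` and which are alive at the birth time of `φ`. -/
def firstAncestors (M : Set (Point d)) (φ : Point d) : Set (Point d) :=
  {ψ ∈ M | ¬ Compatible ψ.1 φ.1 ∧ ψ.2.1 < φ.2.1 ∧ φ.2.1 < ψ.2.1 + ψ.2.2}

/-- `generation M φ n` is the `(n + 1)`-st generation of ancestors of `φ` in `M`. -/
def generation (M : Set (Point d)) (φ : Point d) : ℕ → Set (Point d)
  | 0 => firstAncestors M φ
  | n + 1 => ⋃ ψ ∈ generation M φ n, firstAncestors M ψ

/-- The clan of ancestors of `φ` in `M`. -/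
def clan (M : Set (Point d)) (φ : Point d) : Set (Point d) := ⋃ n, generation M φ n

/-- The points of `M` all of whose first ancestors are in `D`. -/
def keptGiven (M D : Set (Point d)) : Set (Point d) :=
  {φ ∈ M | firstAncestors M φ \ D = ∅}

/-- `deletedAt M n` is the set of points deleted in the first `n` steps: nothing is deleted in
step `0`, and a point is deleted in step `n + 1` if some first ancestor is kept in step
`n + 1`. -/
def deletedAt (M : Set (Point d)) : ℕ → Set (Point d)
  | 0 => ∅
  | n + 1 => {φ ∈ M | (firstAncestors M φ ∩ keptGiven M (deletedAt M n)).Nonempty}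

/-- The kept points. -/
def kept (M : Set (Point d)) : Set (Point d) := ⋃ n, keptGiven M (deletedAt M n)

/-- The loss network driven by `M`, at time `t`: the cycles of the kept points alive at `t`. -/
def lossNetwork (M : Set (Point d)) (t : ℝ) : Config d :=
  {γ | ∃ t' s' : ℝ, (γ, t', s') ∈ kept M ∧ t' ≤ t ∧ t < t' + s'}

/-! ### The dynamics from an initial configuration, and its invariant measures -/

/-- The points of an initial configuration `η` at time `0`, whose cycle `θ` dies at time `s θ`. -/
def initialPoints (η : Config d) (s : FiniteCycle d → ℝ) : Set (Point d) :=
  {φ | φ.1 ∈ η ∧ φ.2.1 = 0 ∧ φ.2.2 = s φ.1}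

/-- The state at time `t` of the loss network that starts at time `0` from `η`, whose initial
cycles have the lifetimes `s`, and which uses the birth attempts of `N` after time `0`. -/
def lossNetworkFrom (η : Config d) (s : FiniteCycle d → ℝ) (N : Set (Point d)) (t : ℝ) :
    Config d :=
  lossNetwork (initialPoints η s ∪ {φ ∈ N | 0 ≤ φ.2.1}) t

/-- `ν` is invariant for the loss network dynamics: if the initial configuration has law `ν`, the
initial cycles have independent exponential lifetimes of rate one, and the birth attempts come
from a Poisson process with intensity `w(γ) dt e^{-s} ds`, the three being independent, then the
state at every time `t ≥ 0` has law `ν`. -/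
def IsInvariant (V : (Fin d → ℤ) → ℝ≥0∞) (α : ℝ) (ν : Measure (Config d)) : Prop :=
  ∀ (Ω : Type u) [MeasurableSpace Ω] (P : Measure Ω) [IsProbabilityMeasure P]
    (N : Ω → Set (Point d)), IsPoissonPointProc N (intensity V α) P →
    ∀ t : ℝ, 0 ≤ t →
      HasLaw (fun z : Config d × (FiniteCycle d → ℝ) × Ω =>
          lossNetworkFrom z.1 z.2.1 (N z.2.2) t) ν
        (ν.prod ((Measure.infinitePi fun _ : FiniteCycle d => expMeasure 1).prod P))

end LossNetwork

end

/-!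
The theorem is proved by coupling from the past. By invariance, and because the intensity is
invariant under translations of the time axis, the network started at time `t - n` from a
configuration `η` of law `ν`, with its own exponential lifetimes, and driven by the birth attempts
of `N` after `t - n`, has law `ν` at time `t`, for every `n`. As `n` tends to infinity this state
converges almost surely, cycle by cycle, to the stationary network driven by all of `N`, so that
the latter also has law `ν`.

For the convergence (`LossNetwork.eventually_mem_lossNetworkFrom_iff`), fix a cycle `γ`. Whether
`γ` is present at time `t` depends only on the clan of ancestors of an attempt of `γ` to be born
at time `t` (`LossNetwork.mem_lossNetwork_iff_of_forall_firstAncestors_eq`). The clan in `N` is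
finite, hence it is born after `t - n` for large `n`, and its cycles meet only finitely many
cycles of `η`, as those have disjoint supports. The finitely many lifetimes involved end before
the first birth in the clan once `n` is large. Then no initial cycle enters the clan, and the
two constructions agree at `γ`.

The limit of the laws is `hasLaw_of_ae_eventually_mem_iff`, which also yields the measurability of
the stationary network: it is an almost sure limit of the states of the dynamics, whose
measurability is part of invariance. These live on the product with the space of the initial data,
which `hasLaw_of_comp_snd` removes.
-/

open Filter

/-! ### Almost sure limits of random sets -/

/-- The events `A ⊆ η`, for finite `A`, generate the product sigma-algebra on sets. -/
theorem measurableSpace_set_eq_generateFrom (ι : Type*) :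
    (Set.instMeasurableSpace : MeasurableSpace (Set ι)) =
      MeasurableSpace.generateFrom (Set.range fun A : Finset ι => {η : Set ι | ↑A ⊆ η}) := by
  apply le_antisymm
  · set C : Set (Set (Set ι)) := Set.range fun A : Finset ι => {η : Set ι | ↑A ⊆ η} with hC
    have hmem : ∀ i, {η : Set ι | i ∈ η} ∈ C := fun i => ⟨{i}, by simp⟩
    have h : Measurable[MeasurableSpace.generateFrom C, Set.instMeasurableSpace] id :=
      (@measurable_set_iff _ _ (_) _).mpr fun i => (@measurableSet_setOfPred _ (_) _).mp <|
        MeasurableSpace.measurableSet_generateFrom (hmem i)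
    exact fun s hs => h hs
  · refine MeasurableSpace.generateFrom_le ?_
    rintro _ ⟨A, rfl⟩
    have : {η : Set ι | ↑A ⊆ η} = ⋂ i ∈ A, {η : Set ι | i ∈ η} := by
      ext η; simp [Set.subset_def]
    change MeasurableSet {η : Set ι | ↑A ⊆ η}
    rw [this]
    exact A.measurableSet_biInter fun i _ => measurableSet_mem i

/-- Two probability measures on sets which give the same mass to the events `A ⊆ η`, for
finite `A`, are equal. -/
theorem ext_of_measure_finset_subset {ι : Type*} {μ ν : Measure (Set ι)} [IsProbabilityMeasure μ]
    [IsProbabilityMeasure ν]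
    (h : ∀ A : Finset ι, μ {η | ↑A ⊆ η} = ν {η | ↑A ⊆ η}) : μ = ν := by
  classical
  refine ext_of_generate_finite _ (measurableSpace_set_eq_generateFrom ι) ?_ ?_ (by simp)
  · rintro _ ⟨A, rfl⟩ _ ⟨B, rfl⟩ -
    exact ⟨A ∪ B, by ext η; simp⟩
  · rintro _ ⟨A, rfl⟩
    exact h A

/-- If random sets with law `ν` converge almost surely to a set `G`, coordinate by coordinate,
then `G` has law `ν`. The measurability of `G` is part of the conclusion. -/
theorem hasLaw_of_ae_eventually_mem_iff {ι X : Type*} [MeasurableSpace X] {Q : Measure X}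
    [IsProbabilityMeasure Q] {ν : Measure (Set ι)} [IsProbabilityMeasure ν]
    {F : ℕ → X → Set ι} {G : X → Set ι} (hF : ∀ n, HasLaw (F n) ν Q)
    (h : ∀ᵐ x ∂Q, ∀ i, ∀ᶠ n in atTop, (i ∈ F n x ↔ i ∈ G x)) : HasLaw G ν Q := by
  set F' : ℕ → X → Set ι := fun n => (hF n).aemeasurable.mk (F n) with hF'
  have hF'm : ∀ n, Measurable (F' n) := fun n => (hF n).aemeasurable.measurable_mk
  have hF'l : ∀ n, HasLaw (F' n) ν Q := fun n => (hF n).congr (hF n).aemeasurable.ae_eq_mk.symm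
  set G' : X → Set ι := fun x => {i | ∀ᶠ n in atTop, i ∈ F' n x} with hG'
  have hG'm : Measurable G' := by
    refine measurable_set_iff.mpr fun i => measurableSet_setOfPred.mp ?_
    have : {x | i ∈ G' x} = ⋃ m, ⋂ n ≥ m, {x | i ∈ F' n x} := by
      ext x; simp [hG', eventually_atTop]
    change MeasurableSet {x | i ∈ G' x}
    rw [this]
    exact .iUnion fun m => .iInter fun n => .iInter fun _ =>
      measurableSet_setOfPred.mpr (measurable_set_iff.mp (hF'm n) i)
  have hlim : ∀ᵐ x ∂Q, G' x = G x ∧ ∀ i, ∀ᶠ n in atTop, (i ∈ F' n x ↔ i ∈ G x) := by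
    filter_upwards [h, ae_all_iff.mpr fun n => (hF n).aemeasurable.ae_eq_mk] with x hx hx'
    have key : ∀ i, ∀ᶠ n in atTop, (i ∈ F' n x ↔ i ∈ G x) := fun i =>
      (hx i).mono fun n hn => by
      rw [← hn, hF', hx' n]
    refine ⟨Set.ext fun i => ?_, key⟩
    simp only [hG', Set.mem_ofPred_eq, eventually_congr (key i), eventually_const]
  refine HasLaw.congr (X := G') ⟨hG'm.aemeasurable, ?_⟩ (hlim.mono fun x hx => hx.1.symm)
  have := Measure.isProbabilityMeasure_map (μ := Q) hG'm.aemeasurable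
  refine ext_of_measure_finset_subset fun A => ?_
  have hA : MeasurableSet {η : Set ι | ↑A ⊆ η} := by
    rw [measurableSpace_set_eq_generateFrom ι]
    exact MeasurableSpace.measurableSet_generateFrom ⟨A, rfl⟩
  have hlimA := tendsto_measure_of_ae_tendsto_indicator_of_isFiniteMeasure atTop (μ := Q)
    (hG'm hA) (fun n => hF'm n hA) (by
      filter_upwards [hlim] with x hx
      have := (A.eventually_all (l := atTop)).mpr fun i _ => hx.2 i
      filter_upwards [this] with n hn
      simp only [Set.mem_preimage, Set.mem_ofPred_eq, Set.subset_def, Finset.mem_coe, hx.1]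
      exact forall₂_congr hn)
  rw [Measure.map_apply hG'm hA]
  refine tendsto_nhds_unique hlimA ?_
  have : ∀ n, Q (F' n ⁻¹' {η : Set ι | ↑A ⊆ η}) = ν {η | ↑A ⊆ η} := fun n => by
    rw [← Measure.map_apply (hF'm n) hA, (hF'l n).map_eq]
  simp only [this, tendsto_const_nhds]

/-- A random variable whose extension to a product has law `ν` has law `ν` itself. -/
theorem hasLaw_of_comp_snd {X Y Z : Type*} [MeasurableSpace X] [MeasurableSpace Y]
    [MeasurableSpace Z] {μ : Measure X} [IsProbabilityMeasure μ] {P : Measure Y} [SFinite P]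
    {ν : Measure Z} {f : Y → Z} (h : HasLaw (fun z : X × Y => f z.2) ν (μ.prod P)) :
    HasLaw f ν P := by
  have hf : AEMeasurable f P := by
    obtain ⟨g, hg, hfg⟩ := h.aemeasurable
    obtain ⟨x, hx⟩ := (Measure.ae_ae_of_ae_prod hfg).exists
    exact ⟨fun y => g (x, y), hg.comp measurable_prodMk_left, hx⟩
  have hmp := measurePreserving_snd (μ := μ) (ν := P)
  refine ⟨hf, ?_⟩
  rw [← h.map_eq, ← congrArg (Measure.map f) hmp.map_eq]
  exact AEMeasurable.map_map_of_aemeasurable (by rwa [hmp.map_eq]) hmp.measurable.aemeasurable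

namespace LossNetwork

variable {d : ℕ}

/-! ### Locality of the construction -/

/-- Whether a point is kept depends only on the points in its clan: `C` is a set of points that
is closed under taking first ancestors. -/
theorem mem_kept_iff_of_forall_firstAncestors_eq {M M' C : Set (Point d)}
    (hM : ∀ φ ∈ C, (φ ∈ M ↔ φ ∈ M'))
    (hanc : ∀ φ ∈ C, firstAncestors M φ = firstAncestors M' φ)
    (hC : ∀ φ ∈ C, firstAncestors M φ ⊆ C) {φ : Point d} (hφ : φ ∈ C) :
    φ ∈ kept M ↔ φ ∈ kept M' := by
  have hK : ∀ D D' : Set (Point d), (∀ φ ∈ C, (φ ∈ D ↔ φ ∈ D')) →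
      ∀ φ ∈ C, (φ ∈ keptGiven M D ↔ φ ∈ keptGiven M' D') := by
    intro D D' hD φ hφ
    simp only [keptGiven, Set.mem_ofPred_eq, Set.sdiff_eq_empty, ← hanc φ hφ, hM φ hφ]
    exact and_congr_right fun _ => forall₂_congr fun ψ hψ => hD ψ (hC φ hφ hψ)
  have hD : ∀ n, ∀ φ ∈ C, (φ ∈ deletedAt M n ↔ φ ∈ deletedAt M' n) := by
    intro n
    induction n with
    | zero => simp [deletedAt]
    | succ n ih =>
      intro φ hφ
      simp only [deletedAt, Set.mem_ofPred_eq, Set.Nonempty, Set.mem_inter_iff, ← hanc φ hφ,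
        hM φ hφ]
      exact and_congr_right fun _ => exists_congr fun ψ => and_congr_right fun hψ =>
        hK _ _ ih ψ (hC φ hφ hψ)
  simp only [kept, Set.mem_iUnion]
  exact exists_congr fun n => hK _ _ (hD n) φ hφ

theorem kept_subset (M : Set (Point d)) : kept M ⊆ M :=
  Set.iUnion_subset fun _ _ h => h.1

theorem not_compatible_self (γ : FiniteCycle d) : ¬ Compatible γ γ := by
  obtain ⟨x, hx, -⟩ := γ.2.1
  rw [Compatible, disjoint_self, Finset.bot_eq_empty]
  exact Finset.ne_empty_of_mem (a := x) (by simpa [FiniteCycle.supp] using hx)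

/-- The state of the cycle `γ` at time `t` is determined by the clan of an attempt of `γ` to be
born at time `t`. -/
theorem mem_lossNetwork_iff_of_forall_firstAncestors_eq {M M' C : Set (Point d)}
    (hM : ∀ φ ∈ C, (φ ∈ M ↔ φ ∈ M'))
    (hanc : ∀ φ ∈ C, firstAncestors M φ = firstAncestors M' φ)
    (hC : ∀ φ ∈ C, firstAncestors M φ ⊆ C) {γ : FiniteCycle d} {t : ℝ}
    (hγ : ∀ s, (γ, t, s) ∈ C) :
    γ ∈ lossNetwork M t ↔ γ ∈ lossNetwork M' t := by
  -- A point with cycle `γ` alive at `t` is born at `t` or is a first ancestor of `(γ, t, 0)`.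
  have mem_C : ∀ t' s', (γ, t', s') ∈ M ∨ (γ, t', s') ∈ M' → t' ≤ t → t < t' + s' →
      (γ, t', s') ∈ C := by
    intro t' s' h h1 h2
    obtain h1 | rfl := h1.lt_or_eq
    · refine hC _ (hγ 0) ?_
      rcases h with h | h
      · exact ⟨h, not_compatible_self γ, h1, h2⟩
      · rw [hanc _ (hγ 0)]
        exact ⟨h, not_compatible_self γ, h1, h2⟩
    · exact hγ s'
  have hk := fun φ hφ => mem_kept_iff_of_forall_firstAncestors_eq hM hanc hC (φ := φ) hφ
  constructor
  · rintro ⟨t', s', h, h1, h2⟩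
    exact ⟨t', s', (hk _ (mem_C _ _ (.inl (kept_subset _ h)) h1 h2)).1 h, h1, h2⟩
  · rintro ⟨t', s', h, h1, h2⟩
    exact ⟨t', s', (hk _ (mem_C _ _ (.inr (kept_subset _ h)) h1 h2)).2 h, h1, h2⟩

theorem firstAncestors_subset_clan (M : Set (Point d)) (φ : Point d) :
    firstAncestors M φ ⊆ clan M φ :=
  Set.subset_iUnion (generation M φ) 0

theorem firstAncestors_subset_clan_of_mem {M : Set (Point d)} {φ ψ : Point d}
    (hψ : ψ ∈ clan M φ) : firstAncestors M ψ ⊆ clan M φ := by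
  obtain ⟨n, hn⟩ := Set.mem_iUnion.1 hψ
  exact (Set.subset_biUnion_of_mem (u := fun ψ => firstAncestors M ψ) hn).trans
    (Set.subset_iUnion (generation M φ) (n + 1))

/-! ### Time shifts -/

/-- Translation of the birth times by `a`. -/
def timeShift (a : ℝ) : Point d ≃ᵐ Point d :=
  (MeasurableEquiv.refl _).prodCongr ((MeasurableEquiv.addRight a).prodCongr (.refl _))

@[simp]
theorem timeShift_apply (a : ℝ) (φ : Point d) :
    timeShift a φ = (φ.1, φ.2.1 + a, φ.2.2) := rfl

theorem firstAncestors_timeShift (a : ℝ) (M : Set (Point d)) (φ : Point d) :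
    firstAncestors (timeShift a ⁻¹' M) φ = timeShift a ⁻¹' firstAncestors M (timeShift a φ) := by
  ext ψ
  simp only [firstAncestors, Set.mem_ofPred_eq, Set.mem_preimage, timeShift_apply,
    add_lt_add_iff_right, add_right_comm _ a]

theorem keptGiven_timeShift (a : ℝ) (M D : Set (Point d)) :
    keptGiven (timeShift a ⁻¹' M) (timeShift a ⁻¹' D) = timeShift a ⁻¹' keptGiven M D := by
  ext φ
  simp only [keptGiven, Set.mem_ofPred_eq, Set.mem_preimage, firstAncestors_timeShift,
    ← Set.preimage_sdiff, Set.preimage_eq_empty_iff, (timeShift a).surjective.range_eq,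
    Set.disjoint_univ]

theorem deletedAt_timeShift (a : ℝ) (M : Set (Point d)) (n : ℕ) :
    deletedAt (timeShift a ⁻¹' M) n = timeShift a ⁻¹' deletedAt M n := by
  induction n with
  | zero => rfl
  | succ n ih =>
    ext φ
    simp only [deletedAt, Set.mem_ofPred_eq, Set.mem_preimage, firstAncestors_timeShift, ih,
      keptGiven_timeShift, ← Set.preimage_inter, (timeShift a).surjective.nonempty_preimage]

theorem kept_timeShift (a : ℝ) (M : Set (Point d)) :
    kept (timeShift a ⁻¹' M) = timeShift a ⁻¹' kept M := by
  simp only [kept, deletedAt_timeShift, keptGiven_timeShift, Set.preimage_iUnion]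

theorem lossNetwork_timeShift (a : ℝ) (M : Set (Point d)) (t : ℝ) :
    lossNetwork (timeShift a ⁻¹' M) t = lossNetwork M (t + a) := by
  ext γ
  simp only [lossNetwork, kept_timeShift, Set.mem_ofPred_eq, Set.mem_preimage, timeShift_apply]
  constructor
  · rintro ⟨t', s', h, h1, h2⟩
    exact ⟨t' + a, s', h, by linarith, by linarith⟩
  · rintro ⟨t', s', h, h1, h2⟩
    exact ⟨t' - a, s', by simpa using h, by linarith, by linarith⟩

/-- There are countably many cycles: each is determined by the finite graph of its restriction to
its support. -/
instance (d : ℕ) : Countable (FiniteCycle d) := by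
  have hinj : Function.Injective fun γ : FiniteCycle d => γ.supp.image fun x => (x, γ.1 x) := by
    intro γ θ h
    have key : ∀ x y, (γ.1 x ≠ x ∧ γ.1 x = y ↔ θ.1 x ≠ x ∧ θ.1 x = y) := by
      intro x y
      simpa [FiniteCycle.supp] using Finset.ext_iff.1 h (x, y)
    refine Subtype.ext (Equiv.ext fun x => ?_)
    by_cases hx : γ.1 x = x
    · by_contra hne
      exact ((key x _).2 ⟨fun h => hne (hx.trans h.symm), rfl⟩).1 hx
    · exact ((key x _).1 ⟨hx, rfl⟩).2.symm
  exact hinj.countable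

theorem measurePreserving_timeShift (V : (Fin d → ℤ) → ℝ≥0∞) (α a : ℝ) :
    MeasurePreserving (timeShift a) (intensity V α) (intensity V α) := by
  have : MeasurableSingletonClass (FiniteCycle d) := ⟨fun _ => trivial⟩
  have := isProbabilityMeasure_expMeasure one_pos
  exact (MeasurePreserving.id _).prod
    ((measurePreserving_add_right volume a).prod (MeasurePreserving.id _))

/-- The points of a Poisson process, moved by an intensity preserving bijection, form a Poisson
process with the same intensity. -/
theorem IsPoissonPointProc.preimage {Ω E : Type*} [MeasurableSpace Ω] [MeasurableSpace E]
    {N : Ω → Set E} {m : Measure E} {P : Measure Ω} (hN : IsPoissonPointProc N m P)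
    (e : E ≃ᵐ E) (he : MeasurePreserving e m m) :
    IsPoissonPointProc (fun ω => e ⁻¹' N ω) m P := by
  have hcount : ∀ (B : Set E) ω, (e ⁻¹' N ω ∩ B).encard = (N ω ∩ e.symm ⁻¹' B).encard := by
    intro B ω
    rw [← e.injective.encard_image, Set.image_preimage_inter, e.image_eq_preimage_symm]
  have hmeas : ∀ B : Set E, MeasurableSet B → MeasurableSet (e.symm ⁻¹' B) :=
    fun B hB => e.symm.measurable hB
  have hm : ∀ B : Set E, MeasurableSet B → m (e.symm ⁻¹' B) = m B := fun B hB =>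
    (he.symm e).measure_preimage hB.nullMeasurableSet
  refine ⟨fun B hB => ?_, fun B hB hB' k => ?_, fun n B hB hdisj => ?_⟩
  · simpa only [hcount] using hN.measurable_count _ (hmeas B hB)
  · simpa only [hcount, hm B hB] using
      hN.count_law _ (hmeas B hB) (by rwa [hm B hB]) k
  · simpa only [hcount] using hN.indep n _ (fun i => hmeas _ (hB i))
      fun i j hij => (hdisj hij).preimage _

/-! ### Forgetting the initial configuration -/

/-- At most one cycle of a finite-cycle configuration passes through each site of the support of
`γ`. -/
theorem IsFiniteCycleConfig.finite_not_compatible {η : Config d} (hη : IsFiniteCycleConfig η)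
    (γ : FiniteCycle d) : {θ ∈ η | ¬ Compatible θ γ}.Finite := by
  have hsub : {θ ∈ η | ¬ Compatible θ γ} ⊆ ⋃ x ∈ γ.supp, {θ ∈ η | x ∈ θ.supp} := by
    rintro θ ⟨hθ, h⟩
    obtain ⟨x, hx, hx'⟩ := Finset.not_disjoint_iff.1 h
    exact Set.mem_biUnion hx' ⟨hθ, hx⟩
  refine (γ.supp.finite_toSet.biUnion fun x _ => Set.Subsingleton.finite ?_).subset hsub
  rintro θ ⟨hθ, hx⟩ θ' ⟨hθ', hx'⟩
  by_contra hne
  exact Finset.disjoint_left.1 (hη hθ hθ' hne) hx hx'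

/-- The loss network started from `η` at time `t - τ` is, up to a shift of the time axis, the
network driven at time `t` by the points of `N` born after `t - τ` and the initial points. -/
theorem lossNetworkFrom_timeShift (η : Config d) (s : FiniteCycle d → ℝ) (N : Set (Point d))
    (t τ : ℝ) :
    lossNetworkFrom η s (timeShift (t - τ) ⁻¹' N) τ =
      lossNetwork ({φ | φ.1 ∈ η ∧ φ.2.1 = t - τ ∧ φ.2.2 = s φ.1} ∪ {φ ∈ N | t - τ ≤ φ.2.1}) t := by
  refine Eq.trans ?_ ((lossNetwork_timeShift (t - τ) _ τ).trans (by rw [add_sub_cancel]))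
  rw [lossNetworkFrom]
  congr 1
  ext φ
  simp [initialPoints, -tsub_le_iff_right]

/-- Coupling from the past: if the clan of a birth of `γ` at time `t` is finite, then the presence
of `γ` at time `t` does not depend on a finite-cycle initial configuration that is placed far
enough in the past. -/
theorem eventually_mem_lossNetworkFrom_iff {η : Config d} (hη : IsFiniteCycleConfig η)
    (s : FiniteCycle d → ℝ) {N : Set (Point d)} {γ : FiniteCycle d} {t : ℝ}
    (hfin : (clan N (γ, t, 0)).Finite) :
    ∀ᶠ τ : ℝ in atTop,
      (γ ∈ lossNetworkFrom η s (timeShift (t - τ) ⁻¹' N) τ ↔ γ ∈ lossNetwork N t) := by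
  set K : Set (FiniteCycle d × ℝ) :=
    insert (γ, t) ((fun φ : Point d => (φ.1, φ.2.1)) '' clan N (γ, t, 0)) with hK
  have hKfin : K.Finite := (hfin.image _).insert _
  set C : Set (Point d) := {φ | φ.1 = γ ∧ φ.2.1 = t} ∪ clan N (γ, t, 0) with hC
  have hCK : ∀ φ ∈ C, (φ.1, φ.2.1) ∈ K := by
    rintro φ (⟨h1, h2⟩ | h)
    · exact .inl (Prod.ext h1 h2)
    · exact .inr ⟨φ, h, rfl⟩
  have hCanc : ∀ φ ∈ C, firstAncestors N φ ⊆ C := by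
    rintro ⟨_, _, r⟩ (⟨rfl, rfl⟩ | h)
    -- The first ancestors do not depend on the lifetime `r`.
    · exact (firstAncestors_subset_clan N (_, _, 0)).trans Set.subset_union_right
    · exact (firstAncestors_subset_clan_of_mem h).trans Set.subset_union_right
  -- The clan is born after `t - τ`.
  have h1 : ∀ᶠ τ : ℝ in atTop, ∀ k ∈ K, t - τ < k.2 :=
    hKfin.eventually_all.2 fun k _ => (eventually_gt_atTop (t - k.2)).mono fun τ h => by linarith
  -- The initial cycles that meet the clan die before the births that they could block.
  have h2 : ∀ᶠ τ : ℝ in atTop, ∀ k ∈ K, ∀ θ ∈ {θ ∈ η | ¬ Compatible θ k.1},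
      t - τ + s θ ≤ k.2 :=
    hKfin.eventually_all.2 fun k _ => (hη.finite_not_compatible k.1).eventually_all.2 fun θ _ =>
      (eventually_ge_atTop (t + s θ - k.2)).mono fun τ h => by linarith
  filter_upwards [h1, h2] with τ h1 h2
  rw [lossNetworkFrom_timeShift]
  symm
  refine mem_lossNetwork_iff_of_forall_firstAncestors_eq (C := C) (fun φ hφ => ?_)
    (fun φ hφ => ?_) hCanc fun r => .inl ⟨rfl, rfl⟩
  · have := h1 _ (hCK φ hφ)
    constructor
    · exact fun h => .inr ⟨h, this.le⟩
    · rintro (⟨-, h, -⟩ | h)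
      · exact absurd h this.ne'
      · exact h.1
  · ext ψ
    constructor
    · intro hψ
      exact ⟨.inr ⟨hψ.1, (h1 _ (hCK ψ (hCanc φ hφ hψ))).le⟩, hψ.2⟩
    · rintro ⟨⟨hη', ht, hs⟩ | h, hcomp, hlt, hlt'⟩
      · have := h2 _ (hCK φ hφ) ψ.1 ⟨hη', hcomp⟩
        simp only [ht, hs] at hlt'
        exact absurd hlt' this.not_gt
      · exact ⟨h.1, hcomp, hlt, hlt'⟩

end LossNetwork

theorem mainTheorem5 {d : ℕ} (V : (Fin d → ℤ) → ℝ≥0∞) (hV : V 0 = 0) (α : ℝ) (hα : 0 < α)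
    {Ω : Type u} [MeasurableSpace Ω] (P : Measure Ω) [IsProbabilityMeasure P]
    (N : Ω → Set (LossNetwork.Point d))
    (hN : LossNetwork.IsPoissonPointProc N (LossNetwork.intensity V α) P)
    (hclan : ∀ᵐ ω ∂P, ∀ φ : LossNetwork.Point d, 0 ≤ φ.2.2 →
      (LossNetwork.clan (N ω) φ).Finite)
    (ν : Measure (LossNetwork.Config d)) [IsProbabilityMeasure ν]
    (hinv : LossNetwork.IsInvariant.{u} V α ν)
    (hsupp : ∀ᵐ η ∂ν, LossNetwork.IsFiniteCycleConfig η) :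
    ∀ t : ℝ, HasLaw (fun ω => LossNetwork.lossNetwork (N ω) t) ν P := by
  intro t
  have := isProbabilityMeasure_expMeasure one_pos
  set E : Measure (LossNetwork.FiniteCycle d → ℝ) :=
    Measure.infinitePi fun _ => expMeasure 1
  have hF (n : ℕ) := hinv Ω P _
    (hN.preimage _ (LossNetwork.measurePreserving_timeShift V α (t - n))) n n.cast_nonneg
  refine hasLaw_of_comp_snd (μ := E) (hasLaw_of_comp_snd (μ := ν) ?_)
  refine hasLaw_of_ae_eventually_mem_iff hF ?_
  filter_upwards [Measure.quasiMeasurePreserving_fst.ae hsupp,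
    (Measure.quasiMeasurePreserving_snd.comp Measure.quasiMeasurePreserving_snd).ae hclan]
    with z hη hN γ
  exact tendsto_natCast_atTop_atTop.eventually
    (LossNetwork.eventually_mem_lossNetworkFrom_iff hη z.2.1 (hN (γ, t, 0) le_rfl))
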